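/- Terminology. All semilattices are join-semilattices. A semilattice \(S\) is distributive if for all \(a_0,a_1,b_0,b_1\in S\) with \(a_0\vee a_1=b_0\vee b_1\) there are \(c_{ij}\in S\) (\(i,j<2\)) with \(a_i=c_{i0}\vee c_{i1}\) and \(b_i=c_{0i}\vee c_{1i}\) for all \(i<2\). The Uniform Refinement Property holds at \(e\in S\) if for all families \((a_i)_{i\in I}\), \((b_i)_{i\in I}\) in \(S\) with \(a_i\vee b_i=e\) for all \(i\in I\), there are families \((a_i^*)_{i\in I}\), \((b_i^*)_{i\in I}\), \((c_{ij})_{(i,j)\in I\times I}\) in \(S\) such that for all \(i,j,k\in I\): \(a_i^*\le a_i\), \(b_i^*\le b_i\), \(a_i^*\vee b_i^*=e\); \(c_{ij}\le a_i^*\), \(c_{ij}\le b_j^*\), \(a_i^*\le a_j^*\vee c_{ij}\); and \(c_{ik}\le c_{ij}\vee c_{jk}\). A semilattice homomorphism \(f\colon S\to T\) is weakly distributive if whenever \(f(u)=y_0\vee y_1\) there are \(x_0,x_1\in S\) with \(x_0\vee x_1=u\), \(f(x_0)\le y_0\) and \(f(x_1)\le y_1\). Rings are associative and unital, not necessarily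 commutative; a ring \(R\) is (von Neumann) regular if for every \(x\in R\) there is \(y\in R\) with \(xyx=x\). Statement. Let \(\kappa\ge\aleph_2\) be a cardinal. Then there exists a bounded distributive semilattice \(S_\kappa\) of cardinality \(\kappa\) that does not satisfy the Uniform Refinement Property at its largest element. Moreover, any semilattice \(S_\kappa\) with these properties is not the image of any distributive lattice under a weakly distributive (join-)semilattice homomorphism, and is not isomorphic to the semilattice of finitely generated two-sided ideals of any von Neumann regular ring. -/

import Mathlib

open scoped Cardinal

universe u v w

/-- A join-semilattice is distributive if it satisfies the refinement property: every equation
`a₀ ⊔ a₁ = b₀ ⊔ b₁` has a `2 × 2` refinement. -/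
def IsDistributiveSemilattice (S : Type u) [SemilatticeSup S] : Prop :=
  ∀ a₀ a₁ b₀ b₁ : S, a₀ ⊔ a₁ = b₀ ⊔ b₁ →
    ∃ c₀₀ c₀₁ c₁₀ c₁₁ : S,
      a₀ = c₀₀ ⊔ c₀₁ ∧ a₁ = c₁₀ ⊔ c₁₁ ∧ b₀ = c₀₀ ⊔ c₁₀ ∧ b₁ = c₀₁ ⊔ c₁₁

/-- The Uniform Refinement Property at an element `e` of a join-semilattice. Index types in the
universe of `S` suffice: a family of decompositions of `e` over any index set is a pullback of the
family of all pairs `(a, b)` with `a ⊔ b = e`. -/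
def UniformRefinementAt {S : Type u} [SemilatticeSup S] (e : S) : Prop :=
  ∀ (I : Type u) (a b : I → S), (∀ i, a i ⊔ b i = e) →
    ∃ (a' b' : I → S) (c : I → I → S),
      (∀ i, a' i ≤ a i ∧ b' i ≤ b i ∧ a' i ⊔ b' i = e) ∧
      (∀ i j, c i j ≤ a' i ∧ c i j ≤ b' j ∧ a' i ≤ a' j ⊔ c i j) ∧
      (∀ i j k, c i k ≤ c i j ⊔ c j k)

/-- A homomorphism of join-semilattices is weakly distributive if every decomposition of an image
`f u` is dominated by the image of a decomposition of `u`. -/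
def IsWeaklyDistributive {S : Type u} {T : Type v} [SemilatticeSup S] [SemilatticeSup T]
    (f : SupHom S T) : Prop :=
  ∀ (x : S) (y₀ y₁ : T), f x = y₀ ⊔ y₁ →
    ∃ x₀ x₁ : S, x₀ ⊔ x₁ = x ∧ f x₀ ≤ y₀ ∧ f x₁ ≤ y₁

/-- The semilattices denoted `S_κ`: bounded distributive join-semilattices of cardinality `κ`
that do not satisfy the Uniform Refinement Property at their largest element. -/
structure IsNonURPSemilattice (κ : Cardinal.{u}) (S : Type u) [SemilatticeSup S]
    [BoundedOrder S] : Prop where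
  card_eq : #S = κ
  distributive : IsDistributiveSemilattice S
  not_uniformRefinementAt_top : ¬ UniformRefinementAt (⊤ : S)

/-- A ring (associative, unital) is von Neumann regular if every `x` has some `y` with
`x * y * x = x`. -/
def IsVonNeumannRegularRing (R : Type v) [Ring R] : Prop :=
  ∀ x : R, ∃ y : R, x * y * x = x

/-- The finitely generated two-sided ideals of a ring, ordered by inclusion. -/
def FGTwoSidedIdeal (R : Type v) [Ring R] : Type v :=
  {J : TwoSidedIdeal R // ∃ s : Finset R, J = TwoSidedIdeal.span (s : Set R)}

theorem TwoSidedIdeal.span_union_eq_sup {R : Type v} [Ring R] (s t : Set R) :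
    TwoSidedIdeal.span (s ∪ t) = TwoSidedIdeal.span s ⊔ TwoSidedIdeal.span t := by
  apply le_antisymm
  · rw [TwoSidedIdeal.span_le]
    rintro x (hx | hx)
    · exact (le_sup_left : TwoSidedIdeal.span s ≤ _) (TwoSidedIdeal.subset_span hx)
    · exact (le_sup_right : TwoSidedIdeal.span t ≤ _) (TwoSidedIdeal.subset_span hx)
  · exact sup_le (TwoSidedIdeal.span_mono Set.subset_union_left)
      (TwoSidedIdeal.span_mono Set.subset_union_right)

/-- The join of two finitely generated two-sided ideals is their join (that is, their sum) in the
lattice of all two-sided ideals. -/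
instance FGTwoSidedIdeal.instSemilatticeSup (R : Type v) [Ring R] :
    SemilatticeSup (FGTwoSidedIdeal R) :=
  Subtype.semilatticeSup (by
    classical
    rintro _ _ ⟨s, rfl⟩ ⟨t, rfl⟩
    exact ⟨s ∪ t, by rw [Finset.coe_union, TwoSidedIdeal.span_union_eq_sup]⟩)

/-! Positive half: in a distributive lattice, decompositions `x i ⊔ y i = u` refine uniformly
through `x i ⊓ y j`, and a weakly distributive map carries this to its image. For ideals of a
regular ring, take `e i` in `a i` with `1 - e i` in `b i`; the ideals generated by `(1 - e j) * e i`
play the role of `c i j`.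

Counterexample: points colour `Ω` by constants or signed atoms. A finite window seeing at most two
of the three atoms resolves a point into constant colourings in which distinct atoms get opposite
values; a window seeing all three cannot, as there are only two truth values, and keeps the point
whole (`Splits`). Resolution is compatible with enlarging windows (`splits_iff_of_subset`), so the
finitely supported sets form a directed union of power-set semilattices, which is distributive.
Given a uniform refinement, `exists_free_triple` yields indices such that the support of each
relevant `c` misses the third index. A point with atoms there satisfies pairwise constraints that
are jointly inconsistent, and this breaks `c j k ≤ c j i ⊔ c i k`. -/

/-! ### Uniform refinement in regular rings -/

namespace TwoSidedIdeal

variable {R : Type v} [Ring R]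

theorem exists_isIdempotentElem_of_sup_eq_top (hR : IsVonNeumannRegularRing R)
    {A B : TwoSidedIdeal R} (h : (1 : R) ∈ A ⊔ B) :
    ∃ e : R, e * e = e ∧ e ∈ A ∧ 1 - e ∈ B := by
  obtain ⟨p, hp, q, hq, hpq⟩ := TwoSidedIdeal.mem_sup.1 h
  obtain ⟨y, hy⟩ := hR p
  refine ⟨p * y, ?_, A.mul_mem_right _ _ hp, ?_⟩
  · rw [← mul_assoc, hy]
  · have : 1 - p * y = (1 - p * y) * q := by
      have : q = 1 - p := by rw [← hpq]; abel
      rw [this, mul_sub, mul_one, sub_mul, one_mul, hy, sub_self, sub_zero]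
    rw [this]
    exact B.mul_mem_left _ _ hq

end TwoSidedIdeal

namespace FGTwoSidedIdeal

variable {R : Type v} [Ring R]

/-- The principal two-sided ideal generated by an element. -/
def principal (x : R) : FGTwoSidedIdeal R :=
  ⟨TwoSidedIdeal.span {x}, {x}, by simp⟩

theorem mem_principal_self (x : R) : x ∈ (principal x).1 :=
  TwoSidedIdeal.subset_span rfl

theorem principal_le {x : R} {J : FGTwoSidedIdeal R} (h : x ∈ J.1) : principal x ≤ J :=
  TwoSidedIdeal.span_le.2 (Set.singleton_subset_iff.2 h)

theorem mem_sup_left {x : R} {J K : FGTwoSidedIdeal R} (h : x ∈ J.1) : x ∈ (J ⊔ K).1 :=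
  (le_sup_left : J ≤ J ⊔ K) h

theorem mem_sup_right {x : R} {J K : FGTwoSidedIdeal R} (h : x ∈ K.1) : x ∈ (J ⊔ K).1 :=
  (le_sup_right : K ≤ J ⊔ K) h

theorem le_principal_one (J : FGTwoSidedIdeal R) : J ≤ principal (1 : R) := fun x _ => by
  simpa using (principal (1 : R)).1.mul_mem_left x 1 (mem_principal_self 1)

theorem exists_uniformRefinement (hR : IsVonNeumannRegularRing R) {I : Type*}
    (a b : I → FGTwoSidedIdeal R) (h : ∀ i, a i ⊔ b i = principal 1) :
    ∃ (a' b' : I → FGTwoSidedIdeal R) (c : I → I → FGTwoSidedIdeal R),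
      (∀ i, a' i ≤ a i ∧ b' i ≤ b i ∧ a' i ⊔ b' i = principal 1) ∧
      (∀ i j, c i j ≤ a' i ∧ c i j ≤ b' j ∧ a' i ≤ a' j ⊔ c i j) ∧
      (∀ i j k, c i k ≤ c i j ⊔ c j k) := by
  have key (i : I) : ∃ e : R, e * e = e ∧ e ∈ (a i).1 ∧ 1 - e ∈ (b i).1 := by
    refine TwoSidedIdeal.exists_isIdempotentElem_of_sup_eq_top hR ?_
    change (1 : R) ∈ (a i ⊔ b i).1
    rw [h i]
    exact mem_principal_self 1
  choose e _ hea heb using key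
  refine ⟨fun i => principal (e i), fun i => principal (1 - e i),
    fun i j => principal ((1 - e j) * e i), fun i => ⟨principal_le (hea i), principal_le (heb i),
      le_antisymm (le_principal_one _) (principal_le ?_)⟩,
    fun i j => ⟨principal_le ?_, principal_le ?_, principal_le ?_⟩,
    fun i j k => principal_le ?_⟩
  · have := (principal (e i) ⊔ principal (1 - e i)).1.add_mem
      (mem_sup_left (mem_principal_self _)) (mem_sup_right (mem_principal_self _))
    simpa using this
  · exact TwoSidedIdeal.mul_mem_left _ _ _ (mem_principal_self _)
  · exact TwoSidedIdeal.mul_mem_right _ _ _ (mem_principal_self _)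
  · have := (principal (e j) ⊔ principal ((1 - e j) * e i)).1.add_mem
      (mem_sup_left (TwoSidedIdeal.mul_mem_right _ _ (e i) (mem_principal_self _)))
      (mem_sup_right (mem_principal_self _))
    rwa [← add_mul, add_sub_cancel, one_mul] at this
  · have := (principal ((1 - e j) * e i) ⊔ principal ((1 - e k) * e j)).1.add_mem
      (mem_sup_left (TwoSidedIdeal.mul_mem_left _ (1 - e k) _ (mem_principal_self _)))
      (mem_sup_right (TwoSidedIdeal.mul_mem_right _ _ (e i) (mem_principal_self _)))
    have h2 : (1 - e k) * ((1 - e j) * e i) + (1 - e k) * e j * e i = (1 - e k) * e i := by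
      noncomm_ring
    rwa [h2] at this

end FGTwoSidedIdeal

theorem uniformRefinementAt_top_of_bijective_fgTwoSidedIdeal {S : Type u} [SemilatticeSup S]
    [BoundedOrder S] {R : Type v} [Ring R] (hR : IsVonNeumannRegularRing R)
    (f : SupHom S (FGTwoSidedIdeal R)) (hf : Function.Bijective f) :
    UniformRefinementAt (⊤ : S) := by
  intro I a b hab
  have le_iff (x y : S) : f x ≤ f y ↔ x ≤ y := by
    rw [← sup_eq_right, ← sup_eq_right, ← map_sup, hf.1.eq_iff]
  obtain ⟨g, hg⟩ := hf.2.hasRightInverse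
  have htop : f ⊤ = FGTwoSidedIdeal.principal 1 := by
    refine le_antisymm (FGTwoSidedIdeal.le_principal_one _) ?_
    rw [← hg (FGTwoSidedIdeal.principal 1), le_iff]
    exact le_top
  obtain ⟨a', b', c, h1, h2, h3⟩ := FGTwoSidedIdeal.exists_uniformRefinement hR
    (fun i => f (a i)) (fun i => f (b i)) (fun i => by rw [← map_sup, hab, htop])
  refine ⟨fun i => g (a' i), fun i => g (b' i), fun i j => g (c i j), fun i => ?_, fun i j => ?_,
    fun i j k => ?_⟩
  · rw [← hf.1.eq_iff, ← le_iff, ← le_iff, map_sup, hg, hg, htop]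
    exact h1 i
  · rw [← le_iff, ← le_iff, ← le_iff, map_sup, hg, hg, hg, hg]
    exact h2 i j
  · rw [← le_iff, map_sup, hg, hg, hg]
    exact h3 i j k

/-! ### Uniform refinement in images of distributive lattices -/

theorem IsWeaklyDistributive.uniformRefinementAt {D : Type w} {S : Type u} [DistribLattice D]
    [SemilatticeSup S] {f : SupHom D S} (hf : IsWeaklyDistributive f) (u : D) :
    UniformRefinementAt (f u) := by
  intro I a b hab
  choose x y hxy hx hy using fun i => hf u (a i) (b i) (hab i).symm
  refine ⟨fun i => f (x i), fun i => f (y i), fun i j => f (x i ⊓ y j),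
    fun i => ⟨hx i, hy i, by rw [← map_sup, hxy]⟩,
    fun i j => ⟨OrderHomClass.mono f inf_le_left, OrderHomClass.mono f inf_le_right, ?_⟩,
    fun i j k => ?_⟩
  · rw [← map_sup]
    refine OrderHomClass.mono f ?_
    rw [sup_inf_left, hxy]
    exact le_inf le_sup_right (hxy i ▸ le_sup_left)
  · rw [← map_sup]
    refine OrderHomClass.mono f ?_
    have h : x i ⊓ y k ≤ x j ⊔ y j := inf_le_left.trans (by rw [hxy, ← hxy i]; exact le_sup_left)
    calc x i ⊓ y k = x i ⊓ y k ⊓ (x j ⊔ y j) := (inf_eq_left.2 h).symm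
      _ = x i ⊓ y k ⊓ x j ⊔ x i ⊓ y k ⊓ y j := inf_sup_left _ _ _
      _ ≤ _ := sup_le (le_sup_of_le_right (le_inf inf_le_right (inf_le_left.trans inf_le_right)))
        (le_sup_of_le_left (le_inf (inf_le_left.trans inf_le_left) inf_le_right))

/-! ### Free triples -/

/-- The case of Kuratowski's free set theorem for pairs: three elements, none of which lies in the
finite set attached to the two others. -/
theorem exists_free_triple {Ω : Type u} (hΩ : Cardinal.aleph 2 ≤ #Ω) (F : Ω → Ω → Finset Ω) :
    ∃ i j k : Ω, i ≠ j ∧ i ≠ k ∧ j ≠ k ∧ i ∉ F j k ∧ j ∉ F i k ∧ k ∉ F i j := by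
  classical
  obtain ⟨M, hM⟩ := Cardinal.le_mk_iff_exists_set.1
    ((Cardinal.aleph_le_aleph.2 (by norm_num : (1 : Ordinal) ≤ 2)).trans hΩ)
  -- Cardinals descend: `k` avoids ℵ₁ many finite sets, then `j` in `M` avoids countably many, then
  -- `i` in `N` avoids one.
  have hM' : ∃ k, k ∉ M ∪ ⋃ p : M × M, (F p.1 p.2 : Set Ω) := by
    by_contra! h
    have h1 : (Set.univ : Set Ω) = M ∪ ⋃ p : M × M, (F p.1 p.2 : Set Ω) :=
      (Set.eq_univ_of_forall h).symm
    have h2 : #(⋃ p : M × M, (F p.1 p.2 : Set Ω)) ≤ Cardinal.aleph 1 := by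
      refine (Cardinal.mk_iUnion_le _).trans ?_
      refine (mul_le_mul' (b := Cardinal.aleph 1) (d := Cardinal.aleph0) ?_ ?_).trans ?_
      · rw [Cardinal.mk_prod, hM]; simp
      · exact ciSup_le' fun p => (Cardinal.lt_aleph0_of_finite _).le
      · simp
    have h3 : #Ω ≤ Cardinal.aleph 1 := by
      rw [← Cardinal.mk_univ, h1]
      refine (Cardinal.mk_union_le _ _).trans ?_
      refine (add_le_add hM.le h2).trans ?_
      simp
    exact absurd (hΩ.trans h3) (not_le.2 (Cardinal.aleph_lt_aleph.2 (by norm_num)))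
  obtain ⟨k, hk⟩ := hM'
  simp only [Set.mem_union, Set.mem_iUnion, not_or, not_exists] at hk
  obtain ⟨hkM, hkF⟩ := hk
  obtain ⟨N, hNM, hN⟩ := Cardinal.le_mk_iff_exists_subset.1
    ((Cardinal.aleph0_le_aleph 1).trans hM.ge)
  have hN' : ∃ j ∈ M, j ∉ N ∪ ⋃ i ∈ N, (F i k : Set Ω) := by
    by_contra! h
    have hNc : N.Countable := by rw [← Cardinal.le_aleph0_iff_set_countable, hN]
    have hc : M.Countable :=
      (hNc.union (hNc.biUnion fun i _ => (F i k).countable_toSet)).mono h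
    rw [← Cardinal.le_aleph0_iff_set_countable, hM] at hc
    exact absurd hc (not_le.2 (by
      rw [← Cardinal.aleph_zero]; exact Cardinal.aleph_lt_aleph.2 zero_lt_one))
  obtain ⟨j, hjM, hj⟩ := hN'
  simp only [Set.mem_union, Set.mem_iUnion, not_or, not_exists] at hj
  have hNi : N.Infinite := by
    rw [← Set.infinite_coe_iff, Cardinal.infinite_iff, hN]
  obtain ⟨i, hiN, hi⟩ := hNi.exists_notMem_finset (F j k)
  refine ⟨i, j, k, ?_, ?_, ?_, hi, fun h => hj.2 i hiN h, fun h => hkF (⟨i, hNM hiN⟩, ⟨j, hjM⟩) h⟩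
  · rintro rfl; exact hj.1 hiN
  · rintro rfl; exact hkM (hNM hiN)
  · rintro rfl; exact hkM hjM

/-! ### Colours, valuations and splittings -/

/-- The colour of a point at an index: one of two constants `(s, none)`, or a signed atom
`(s, some p)`. -/
abbrev AtomColour : Type := Bool × Option (Fin 3)

namespace AtomColour

/-- The constant colour obtained from a truth value of each of the atoms. -/
def eval (v : Fin 3 → Bool) : AtomColour → AtomColour
  | (s, none) => (s, none)
  | (s, some p) => (s == v p, none)

@[simp] theorem eval_none (v : Fin 3 → Bool) (s : Bool) : eval v (s, none) = (s, none) := rfl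

@[simp] theorem eval_some (v : Fin 3 → Bool) (s : Bool) (p : Fin 3) :
    eval v (s, some p) = (s == v p, none) := rfl

@[simp] theorem eval_snd (v : Fin 3 → Bool) (x : AtomColour) : (eval v x).2 = none := by
  rcases x with ⟨s, _ | p⟩ <;> rfl

/-- Two distinct atoms of `A` receive distinct truth values. -/
def Separates (v : Fin 3 → Bool) (A : Finset (Fin 3)) : Prop :=
  ∀ p ∈ A, ∀ q ∈ A, p ≠ q → v p ≠ v q

instance (v : Fin 3 → Bool) (A : Finset (Fin 3)) : Decidable (Separates v A) :=
  inferInstanceAs (Decidable (∀ p ∈ A, ∀ q ∈ A, p ≠ q → v p ≠ v q))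

theorem Separates.mono {v : Fin 3 → Bool} {A B : Finset (Fin 3)} (h : Separates v B)
    (hAB : A ⊆ B) : Separates v A :=
  fun p hp q hq => h p (hAB hp) q (hAB hq)

set_option maxRecDepth 100000 in
theorem Separates.exists_extension : ∀ {v : Fin 3 → Bool} {A B : Finset (Fin 3)},
    Separates v A → A ⊆ B → B ≠ Finset.univ →
    ∃ v', Separates v' B ∧ ∀ p ∈ A, v' p = v p := by
  decide

variable {Ω : Type u}

/-- The atoms that occur in `f` on `F`. -/
def atoms (F : Finset Ω) (f : Ω → AtomColour) : Finset (Fin 3) :=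
  Finset.univ.filter fun p => ∃ i ∈ F, (f i).2 = some p

theorem mem_atoms {F : Finset Ω} {f : Ω → AtomColour} {p : Fin 3} :
    p ∈ atoms F f ↔ ∃ i ∈ F, (f i).2 = some p := by
  simp [atoms]

theorem atoms_mono {F G : Finset Ω} (h : F ⊆ G) (f : Ω → AtomColour) :
    atoms F f ⊆ atoms G f := fun p hp => by
  obtain ⟨i, hi, hp⟩ := mem_atoms.1 hp
  exact mem_atoms.2 ⟨i, h hi, hp⟩

theorem atoms_congr {F : Finset Ω} {f g : Ω → AtomColour} (h : ∀ i ∈ F, f i = g i) :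
    atoms F f = atoms F g := by
  ext p
  simp only [mem_atoms]
  exact exists_congr fun i => and_congr_right fun hi => by rw [h i hi]

theorem atoms_eval (F : Finset Ω) (v : Fin 3 → Bool) (f : Ω → AtomColour) :
    atoms F (fun i => eval v (f i)) = ∅ := by
  ext p
  simp [mem_atoms]

variable [DecidableEq Ω]

/-- The point that agrees with `f` on `F` and is constant elsewhere. -/
def restrict (F : Finset Ω) (f : Ω → AtomColour) : Ω → AtomColour :=
  fun i => if i ∈ F then f i else (false, none)

theorem restrict_congr {F : Finset Ω} {f g : Ω → AtomColour} (h : ∀ i ∈ F, f i = g i) :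
    restrict F f = restrict F g := by
  ext1 i
  by_cases hi : i ∈ F <;> simp [restrict, hi, h]

theorem restrict_apply_of_mem {F : Finset Ω} {i : Ω} (hi : i ∈ F) (f : Ω → AtomColour) :
    restrict F f i = f i := if_pos hi

/-- A point splits over `F` into itself if all three atoms occur, and into two points without
atoms if not. -/
inductive Splits (F : Finset Ω) (f : Ω → AtomColour) : (Ω → AtomColour) → Prop
  | full (h : atoms F f = Finset.univ) : Splits F f (restrict F f)
  | eval (v : Fin 3 → Bool) (hv : Separates v (atoms F f)) :
      Splits F f (restrict F fun i => AtomColour.eval v (f i))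

theorem splits_congr {F : Finset Ω} {f g h : Ω → AtomColour} (hfg : ∀ i ∈ F, f i = g i) :
    Splits F f h → Splits F g h := by
  rintro (hf | ⟨v, hv⟩)
  · rw [restrict_congr hfg]
    exact .full (atoms_congr hfg ▸ hf)
  · rw [restrict_congr (g := fun i => AtomColour.eval v (g i)) fun i hi => by simp only [hfg i hi]]
    exact .eval v (atoms_congr hfg ▸ hv)

theorem splits_eval_iff {F : Finset Ω} {v : Fin 3 → Bool} {f g : Ω → AtomColour} :
    Splits F (fun i => eval v (f i)) g ↔ g = restrict F fun i => eval v (f i) := by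
  have hr (w : Fin 3 → Bool) :
      (fun i => eval w (eval v (f i))) = fun i => eval v (f i) := by
    ext1 i
    rcases f i with ⟨s, _ | p⟩ <;> rfl
  constructor
  · rintro (h | ⟨w, -⟩)
    · rfl
    · rw [hr]
  · rintro rfl
    have := Splits.eval (F := F) (f := fun i => eval v (f i)) v (by
      rw [atoms_eval]; intro p hp; simp at hp)
    rwa [hr] at this

theorem splits_restrict_iff {F G : Finset Ω} (h : F ⊆ G) {f g : Ω → AtomColour} :
    Splits F (restrict G f) g ↔ Splits F f g :=
  ⟨splits_congr fun _ hi => restrict_apply_of_mem (h hi) f,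
    splits_congr fun _ hi => (restrict_apply_of_mem (h hi) f).symm⟩

theorem exists_eval_of_separates {F : Finset Ω} {f : Ω → AtomColour} {v : Fin 3 → Bool}
    (hv : Separates v (atoms F f)) {B : Finset (Fin 3)} (hB : atoms F f ⊆ B)
    (hB' : B ≠ Finset.univ) :
    ∃ v', Separates v' B ∧
      restrict F (fun i => eval v' (f i)) = restrict F fun i => eval v (f i) := by
  obtain ⟨v', h1, h2⟩ := hv.exists_extension hB hB'
  refine ⟨v', h1, restrict_congr fun i hi => ?_⟩
  rcases hfi : f i with ⟨s, _ | p⟩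
  · rfl
  · simp [h2 p (mem_atoms.2 ⟨i, hi, by rw [hfi]⟩)]

/-- If `G` sees all three atoms, splitting over `G` changes nothing on `F`. Otherwise a valuation
separating the atoms on `F` extends to one separating those on `G`. -/
theorem splits_iff_of_subset {F G : Finset Ω} (h : F ⊆ G) {f g : Ω → AtomColour} :
    Splits F f g ↔ ∃ k, Splits G f k ∧ Splits F k g := by
  constructor
  · intro hg
    by_cases hG : atoms G f = Finset.univ
    · exact ⟨_, .full hG, (splits_restrict_iff h).2 hg⟩
    · rcases hg with hF | ⟨v, hv⟩
      · exact absurd (Finset.univ_subset_iff.1 (hF ▸ atoms_mono h f)) hG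
      · obtain ⟨v', h1, h2⟩ := exists_eval_of_separates hv (atoms_mono h f) hG
        exact ⟨_, .eval v' h1, by rw [splits_restrict_iff h, splits_eval_iff, h2]⟩
  · rintro ⟨k, hk | ⟨v, hv⟩, hg⟩
    · exact (splits_restrict_iff h).1 hg
    · rw [splits_restrict_iff h, splits_eval_iff] at hg
      rw [hg]
      exact .eval v (hv.mono (atoms_mono h f))

theorem exists_splits (F : Finset Ω) (f : Ω → AtomColour) : ∃ g, Splits F f g := by
  by_cases hF : atoms F f = Finset.univ
  · exact ⟨_, .full hF⟩
  · have h0 : Separates (fun _ => true) ∅ := fun p hp => by simp at hp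
    obtain ⟨v, hv, -⟩ := h0.exists_extension (Finset.empty_subset _) hF
    exact ⟨_, .eval v hv⟩

theorem Splits.restrict_eq {F : Finset Ω} {f g : Ω → AtomColour} (h : Splits F f g) :
    restrict F g = g := by
  rcases h with h | ⟨v, hv⟩ <;>
  exact restrict_congr fun i hi => restrict_apply_of_mem hi _

/-! ### Finitely supported sets -/

/-- Membership in `U` is determined by the splitting over `F`. -/
def SupportedBy (F : Finset Ω) (U : Set (Ω → AtomColour)) : Prop :=
  ∀ f, f ∈ U ↔ ∃ g, Splits F f g ∧ g ∈ U

theorem supportedBy_setOf_splits (F : Finset Ω) (W : Set (Ω → AtomColour)) :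
    SupportedBy F {f | ∃ g, Splits F f g ∧ g ∈ W} := fun f => by
  constructor
  · rintro ⟨g, hg, hW⟩
    obtain ⟨k, hk, hkg⟩ := (splits_iff_of_subset (Finset.Subset.refl F)).1 hg
    exact ⟨k, hk, g, hkg, hW⟩
  · rintro ⟨k, hk, g, hkg, hW⟩
    exact ⟨g, (splits_iff_of_subset (Finset.Subset.refl F)).2 ⟨k, hk, hkg⟩, hW⟩

theorem SupportedBy.mono {F G : Finset Ω} {U : Set (Ω → AtomColour)} (hU : SupportedBy F U)
    (h : F ⊆ G) : SupportedBy G U := fun f => by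
  rw [hU f]
  constructor
  · rintro ⟨g, hg, hgU⟩
    obtain ⟨k, hk, hkg⟩ := (splits_iff_of_subset h).1 hg
    exact ⟨k, hk, (hU k).2 ⟨g, hkg, hgU⟩⟩
  · rintro ⟨k, hk, hkU⟩
    obtain ⟨g, hkg, hgU⟩ := (hU k).1 hkU
    exact ⟨g, (splits_iff_of_subset h).2 ⟨k, hk, hkg⟩, hgU⟩

theorem SupportedBy.union {F : Finset Ω} {U W : Set (Ω → AtomColour)} (hU : SupportedBy F U)
    (hW : SupportedBy F W) : SupportedBy F (U ∪ W) := fun f => by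
  simp only [Set.mem_union, hU f, hW f, and_or_left, exists_or]

theorem supportedBy_empty (F : Finset Ω) : SupportedBy F ∅ := fun f => by simp

theorem supportedBy_univ (F : Finset Ω) : SupportedBy F Set.univ := fun f => by
  simpa using exists_splits F f

/-- `B` may exceed the atoms seen on `F`, so two atoms can be separated even when the support misses
the indices carrying them. -/
theorem SupportedBy.mem_iff {F : Finset Ω} {U : Set (Ω → AtomColour)} (hU : SupportedBy F U)
    {f : Ω → AtomColour} {B : Finset (Fin 3)} (hB : atoms F f ⊆ B) (hB' : B ≠ Finset.univ) :
    f ∈ U ↔ ∃ v, Separates v B ∧ (fun i => eval v (f i)) ∈ U := by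
  have key (v : Fin 3 → Bool) :
      (fun i => eval v (f i)) ∈ U ↔ restrict F (fun i => eval v (f i)) ∈ U := by
    rw [hU]
    simp [splits_eval_iff]
  simp only [key]
  rw [hU f]
  constructor
  · rintro ⟨g, hF | ⟨v, hv⟩, hgU⟩
    · exact absurd (Finset.univ_subset_iff.1 (hF ▸ hB)) hB'
    · obtain ⟨v', h1, h2⟩ := exists_eval_of_separates hv hB hB'
      exact ⟨v', h1, h2 ▸ hgU⟩
  · rintro ⟨v, hv, hvU⟩
    exact ⟨_, .eval v (hv.mono hB), hvU⟩

theorem supportedBy_singleton_ne (i : Ω) (s : Bool) :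
    SupportedBy {i} {f : Ω → AtomColour | f i ≠ (s, none)} := fun f => by
  rcases hfi : f i with ⟨t, _ | p⟩
  · have key (g) (hg : Splits {i} f g) : g i = (t, none) := by
      rcases hg with h | ⟨v, hv⟩ <;> simp [restrict, hfi]
    obtain ⟨g₀, hg₀⟩ := exists_splits {i} f
    simp only [Set.mem_ofPred_eq, hfi]
    exact ⟨fun h => ⟨g₀, hg₀, by rwa [key g₀ hg₀]⟩, fun ⟨g, hg, h⟩ => by rwa [key g hg] at h⟩
  · simp only [Set.mem_ofPred_eq, hfi]
    -- This valuation turns the atom at `i`, of sign `t`, into the constant `!s`.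
    refine iff_of_true (by simp) ⟨_, .eval (fun _ => t == !s) ?_, ?_⟩
    · intro p hp q hq hpq
      simp only [mem_atoms, Finset.mem_singleton, exists_eq_left, hfi, Option.some.injEq] at hp hq
      exact absurd (hp.symm.trans hq) hpq
    · cases s <;> cases t <;> simp [restrict, hfi]

/-! ### The semilattice and its properties -/

variable (Ω) in
/-- The join-semilattice of finitely supported sets of points. -/
def FinitelySupported : Type u :=
  {U : Set (Ω → AtomColour) // ∃ F : Finset Ω, SupportedBy F U}

namespace FinitelySupported

instance : SemilatticeSup (FinitelySupported Ω) :=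
  Subtype.semilatticeSup (by
    rintro U W ⟨F, hF⟩ ⟨G, hG⟩
    exact ⟨F ∪ G, (hF.mono Finset.subset_union_left).union (hG.mono Finset.subset_union_right)⟩)

instance : BoundedOrder (FinitelySupported Ω) where
  top := ⟨Set.univ, ∅, supportedBy_univ ∅⟩
  le_top U := Set.subset_univ U.1
  bot := ⟨∅, ∅, supportedBy_empty ∅⟩
  bot_le U := Set.empty_subset U.1

theorem isDistributiveSemilattice : IsDistributiveSemilattice (FinitelySupported Ω) := by
  rintro ⟨a₀, A₀, ha₀⟩ ⟨a₁, A₁, ha₁⟩ ⟨b₀, B₀, hb₀⟩ ⟨b₁, B₁, hb₁⟩ h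
  have h : a₀ ∪ a₁ = b₀ ∪ b₁ := congrArg Subtype.val h
  obtain ⟨F, h₀, h₁, h₂, h₃⟩ : ∃ F, A₀ ⊆ F ∧ A₁ ⊆ F ∧ B₀ ⊆ F ∧ B₁ ⊆ F :=
    ⟨A₀ ∪ A₁ ∪ (B₀ ∪ B₁), by grind, by grind, by grind, by grind⟩
  replace ha₀ := ha₀.mono h₀
  replace ha₁ := ha₁.mono h₁
  replace hb₀ := hb₀.mono h₂
  replace hb₁ := hb₁.mono h₃
  -- `a ∩ b` itself need not be supported by `F`: a point may have one split in `a` and another in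
  -- `b`. Only a common split counts.
  let c (a b : Set (Ω → AtomColour)) : FinitelySupported Ω :=
    ⟨{f | ∃ g, Splits F f g ∧ g ∈ a ∩ b}, F, supportedBy_setOf_splits F _⟩
  have left {a b b' : Set (Ω → AtomColour)} (ha : SupportedBy F a) (hab : a ⊆ b ∪ b') :
      a = (c a b ⊔ c a b').1 := by
    ext f
    rw [ha f]
    constructor
    · rintro ⟨g, hg, hga⟩
      exact (hab hga).imp (fun hb => ⟨g, hg, hga, hb⟩) fun hb => ⟨g, hg, hga, hb⟩
    · rintro (⟨g, hg, hgab⟩ | ⟨g, hg, hgab⟩) <;> exact ⟨g, hg, hgab.1⟩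
  have comm (a b : Set (Ω → AtomColour)) : c a b = c b a :=
    Subtype.ext (Set.ext fun f => exists_congr fun g => and_congr_right fun _ => and_comm)
  refine ⟨c a₀ b₀, c a₀ b₁, c a₁ b₀, c a₁ b₁, Subtype.ext (left ha₀ ?_), Subtype.ext (left ha₁ ?_),
    ?_, ?_⟩
  · exact h ▸ Set.subset_union_left
  · exact h ▸ Set.subset_union_right
  · rw [comm a₀, comm a₁]
    exact Subtype.ext (left hb₀ (h ▸ Set.subset_union_left))
  · rw [comm a₀, comm a₁]
    exact Subtype.ext (left hb₁ (h ▸ Set.subset_union_right))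

/-- The set of points that differ from a given constant at `i`. -/
def ne (i : Ω) (s : Bool) : FinitelySupported Ω :=
  ⟨{f | f i ≠ (s, none)}, {i}, supportedBy_singleton_ne i s⟩

theorem ne_sup_ne (i : Ω) : ne i true ⊔ ne i false = (⊤ : FinitelySupported Ω) := by
  refine Subtype.ext (Set.eq_univ_of_forall fun f => ?_)
  change f i ≠ _ ∨ f i ≠ _
  by_contra! h
  exact absurd (h.1.symm.trans h.2) (by simp)

theorem mk_eq [Infinite Ω] : #(FinitelySupported Ω) = #Ω := by
  apply le_antisymm
  -- The default `(false, none)` is that of `restrict`, so every split point over the support is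
  -- recovered from its trace.
  · let φ : FinitelySupported Ω → Σ F : Finset Ω, Set (F → AtomColour) := fun U =>
      ⟨U.2.choose, {x | (fun i => if h : i ∈ U.2.choose then x ⟨i, h⟩ else (false, none)) ∈ U.1}⟩
    have hφ : Function.Injective φ := by
      intro U W h
      obtain ⟨h1, h2⟩ := Sigma.mk.inj h
      have hU := U.2.choose_spec
      have hW := W.2.choose_spec
      generalize U.2.choose = F at *
      generalize W.2.choose = G at *
      subst h1
      have h2 := eq_of_heq h2
      refine Subtype.ext (Set.ext fun f => ?_)
      rw [hU f, hW f]
      refine exists_congr fun g => and_congr_right fun hg => ?_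
      have := congrArg (fun s => (fun i : F => g i) ∈ s) h2
      have hr : (fun i => if h : i ∈ F then g i else (false, none)) = g := by
        conv_rhs => rw [← hg.restrict_eq]
        ext1 i
        simp [restrict]
      simp only [Set.mem_ofPred_eq, hr] at this
      exact this ▸ Iff.rfl
    refine (Cardinal.mk_le_of_injective hφ).trans ?_
    rw [Cardinal.mk_sigma]
    refine (Cardinal.sum_le_mk_mul_iSup _).trans ?_
    rw [Cardinal.mk_finset_of_infinite]
    have hfin (F : Finset Ω) : #(Set (F → AtomColour)) ≤ Cardinal.aleph0 :=
      (Cardinal.lt_aleph0_of_finite _).le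
    refine (mul_le_mul' le_rfl (ciSup_le' hfin)).trans ?_
    rw [Cardinal.mul_aleph0_eq (Cardinal.aleph0_le_mk Ω)]
  · refine Cardinal.mk_le_of_injective (f := fun i => ne i true) fun i j hij => ?_
    by_contra hne
    have : (fun k => if k = i then (true, none) else (false, none)) ∈ (ne i true).1 := by
      simp only [hij]
      simp [ne, Ne.symm hne]
    simp [ne] at this

theorem not_uniformRefinementAt_top (hΩ : Cardinal.aleph 2 ≤ #Ω) :
    ¬ UniformRefinementAt (⊤ : FinitelySupported Ω) := by
  intro h
  obtain ⟨a, b, c, hab, hc, hcc⟩ := h Ω (fun i => ne i true) (fun i => ne i false) ne_sup_ne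
  choose F hF using fun i j => (c i j).2
  obtain ⟨i, j, k, hij, hik, hjk, hi, hj, hk⟩ :=
    exists_free_triple hΩ fun i j => F i j ∪ F j i
  simp only [Finset.mem_union, not_or] at hi hj hk
  have sub (x y : Ω) (f : Ω → AtomColour) (hf : f ∈ (c x y).1) :
      f x ≠ (true, none) ∧ f y ≠ (false, none) :=
    ⟨(hab x).1 ((hc x y).1 hf), (hab y).2.1 ((hc x y).2.1 hf)⟩
  have sup (x y : Ω) (f : Ω → AtomColour) (hx : f x = (false, none)) (hy : f y = (true, none)) :
      f ∈ (c x y).1 := by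
    have hx' : f ∈ (a x).1 := by
      have : f ∈ (a x ⊔ b x).1 := by rw [(hab x).2.2]; trivial
      exact this.resolve_right fun hb => (hab x).2.1 hb hx
    exact ((hc x y).2.2 hx').resolve_left fun ha => (hab y).1 ha hy
  -- With these signs, separating valuations give `i` and `j` equal colours, `i` and `k` equal
  -- colours, but `j` and `k` different ones.
  let f : Ω → AtomColour := fun l =>
    if l = i then (true, some 0) else if l = j then (false, some 1) else
      if l = k then (false, some 2) else (false, none)
  have fi : f i = (true, some 0) := by simp [f]
  have fj : f j = (false, some 1) := by simp [f, hij.symm]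
  have fk : f k = (false, some 2) := by simp [f, hik.symm, hjk.symm]
  have hat {l : Ω} {m : Fin 3} (hl : ∀ l', (f l').2 = some m → l' = l) {G : Finset Ω}
      (hG : l ∉ G) : atoms G f ⊆ {m}ᶜ := by
    intro p hp
    obtain ⟨l', hl', hp⟩ := mem_atoms.1 hp
    rw [Finset.mem_compl, Finset.mem_singleton]
    rintro rfl
    exact hG (hl l' hp ▸ hl')
  have hjk' : f ∈ (c j k).1 := by
    rw [(hF j k).mem_iff (hat (l := i) (m := 0) (by grind) hi.1) (by decide)]
    exact ⟨![true, true, false], by decide, sup j k _ (by simp [fj]) (by simp [fk])⟩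
  rcases hcc j i k hjk' with h | h
  · rw [(hF j i).mem_iff (hat (l := k) (m := 2) (by grind) hk.2) (by decide)] at h
    obtain ⟨v, hv, h⟩ := h
    have h1 := sub _ _ _ h
    have h2 := hv 0 (by decide) 1 (by decide) (by decide)
    simp only [fi, fj, eval_some] at h1
    revert h1 h2
    cases v 0 <;> cases v 1 <;> simp
  · rw [(hF i k).mem_iff (hat (l := j) (m := 1) (by grind) hj.1) (by decide)] at h
    obtain ⟨v, hv, h⟩ := h
    have h1 := sub _ _ _ h
    have h2 := hv 0 (by decide) 2 (by decide) (by decide)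
    simp only [fi, fk, eval_some] at h1
    revert h1 h2
    cases v 0 <;> cases v 2 <;> simp

end FinitelySupported

end AtomColour

theorem corollary4p5 (κ : Cardinal.{u}) (hκ : Cardinal.aleph 2 ≤ κ) :
    (∃ (S : Type u) (_ : SemilatticeSup S) (_ : BoundedOrder S), IsNonURPSemilattice κ S) ∧
    ∀ (S : Type u) [SemilatticeSup S] [BoundedOrder S], IsNonURPSemilattice κ S →
      (∀ (D : Type w) [DistribLattice D] (f : SupHom D S),
        IsWeaklyDistributive f → ¬ Function.Surjective f) ∧
      ∀ (R : Type v) [Ring R], IsVonNeumannRegularRing R →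
        ¬ ∃ f : SupHom S (FGTwoSidedIdeal R), Function.Bijective f := by
  classical
  refine ⟨?_, fun S _ _ hS => ⟨fun D _ f hf hsurj => ?_, fun R _ hR ⟨f, hf⟩ => ?_⟩⟩
  · have hΩ : Cardinal.aleph 2 ≤ #κ.out := by rwa [Cardinal.mk_out]
    have : Infinite κ.out := Cardinal.infinite_iff.2 ((Cardinal.aleph0_le_aleph 2).trans hΩ)
    exact ⟨AtomColour.FinitelySupported κ.out, inferInstance, inferInstance,
      by rw [AtomColour.FinitelySupported.mk_eq, Cardinal.mk_out],
      AtomColour.FinitelySupported.isDistributiveSemilattice,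
      AtomColour.FinitelySupported.not_uniformRefinementAt_top hΩ⟩
  · obtain ⟨u, hu⟩ := hsurj ⊤
    exact hS.not_uniformRefinementAt_top (hu ▸ hf.uniformRefinementAt u)
  · exact hS.not_uniformRefinementAt_top
      (uniformRefinementAt_top_of_bijective_fgTwoSidedIdeal hR f hf)
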